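/- Let $S_\infty$ be the group of all permutations of $\mathbb{N}$, equipped with the topology of pointwise convergence. For a standard probability space $(X,\mu)$, denote by $\operatorname{Aut}_{\mathrm{mp}}(X,\mu)$ the group of measure preserving automorphisms of $(X,\mu)$, identifying two automorphisms that coincide almost everywhere, with its usual Polish topology, in which $\alpha_i \to \alpha$ if and only if $\mu(\alpha_i^{-1}(A) \mathbin{\triangle} \alpha^{-1}(A)) \to 0$ for every measurable $A \subset X$. A Polish group $G$ is called a centralizer group if there exist a standard probability space $(X,\mu)$ and an ergodic probability measure preserving action $\Lambda \curvearrowright (X,\mu)$ of a countable group $\Lambda$ such that $G$ is isomorphic, as a topological group, to the centralizer of (the image of) $\Lambda$ inside $\operatorname{Aut}_{\mathrm{mp}}(X,\mu)$. Theorem. Every closed subgroup $G$ of $S_\infty$ (with the subspace topology) is a Polish group and is a centralizer group. -/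

import Mathlib

open MeasureTheory
open scoped symmDiff ENNReal

/-- The group `S_∞` of all permutations of `ℕ`. -/
abbrev SInfty : Type := Equiv.Perm ℕ

/-- The topology of pointwise convergence on `S_∞`, with `ℕ` discrete. -/
instance SInfty.instTopologicalSpace : TopologicalSpace SInfty :=
  TopologicalSpace.induced (fun (σ : SInfty) (n : ℕ) => σ n) inferInstance

section Automorphisms

variable {X : Type*} [MeasurableSpace X]

/-- The measure preserving bijections of `(X, μ)` with measurable inverse, as a group under
composition. -/
def mpPerm (μ : Measure X) : Subgroup (Equiv.Perm X) where
  carrier := {e | MeasurePreserving e μ μ ∧ MeasurePreserving e.symm μ μ}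
  mul_mem' := fun ha hb => ⟨ha.1.comp hb.1, hb.2.comp ha.2⟩
  one_mem' := ⟨MeasurePreserving.id μ, MeasurePreserving.id μ⟩
  inv_mem' := fun ha => ⟨ha.2, ha.1⟩

/-- The automorphisms that coincide with the identity almost everywhere. -/
def aeTrivial (μ : Measure X) : Subgroup (mpPerm μ) where
  carrier := {e | ∀ᵐ x ∂μ, (e : Equiv.Perm X) x = x}
  mul_mem' := by
    intro a b ha hb
    filter_upwards [hb, b.2.1.quasiMeasurePreserving.ae ha] with x hx hx'
    exact hx'.trans hx
  one_mem' := show ∀ᵐ x ∂μ, ((1 : mpPerm μ) : Equiv.Perm X) x = x from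
    Filter.Eventually.of_forall fun _ => rfl
  inv_mem' := by
    intro a ha
    filter_upwards [a.2.2.quasiMeasurePreserving.ae ha] with x hx
    have h : (a : Equiv.Perm X) ((a : Equiv.Perm X).symm x) = x := Equiv.apply_symm_apply _ _
    exact hx.symm.trans h

instance aeTrivial_normal (μ : Measure X) : (aeTrivial μ).Normal where
  conj_mem := by
    intro a ha g
    filter_upwards [g.2.2.quasiMeasurePreserving.ae ha] with x hx
    have h : (g : Equiv.Perm X) ((g : Equiv.Perm X).symm x) = x := Equiv.apply_symm_apply _ _
    exact (congrArg (g : Equiv.Perm X) hx).trans h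

/-- `Aut_mp(X, μ)`: measure preserving automorphisms of `(X, μ)`, two of them being identified
when they coincide almost everywhere. -/
def AutMP (μ : Measure X) : Type _ := mpPerm μ ⧸ aeTrivial μ

instance AutMP.instGroup (μ : Measure X) : Group (AutMP μ) :=
  inferInstanceAs (Group (mpPerm μ ⧸ aeTrivial μ))

/-- The class of an automorphism in `Aut_mp(X, μ)`. -/
def AutMP.mk (μ : Measure X) : mpPerm μ →* AutMP μ := QuotientGroup.mk' (aeTrivial μ)

theorem AutMP.mk_eq_mk_iff (μ : Measure X) (a b : mpPerm μ) :
    AutMP.mk μ a = AutMP.mk μ b ↔ ∀ᵐ x ∂μ, (a : Equiv.Perm X) x = (b : Equiv.Perm X) x := by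
  refine (QuotientGroup.eq (s := aeTrivial μ)).trans ⟨fun h => ?_, fun h => ?_⟩
  · filter_upwards [(show ∀ᵐ x ∂μ, (a : Equiv.Perm X).symm ((b : Equiv.Perm X) x) = x from h)]
      with x hx
    exact ((Equiv.symm_apply_eq _).1 hx).symm
  · refine (show ∀ᵐ x ∂μ, (a : Equiv.Perm X).symm ((b : Equiv.Perm X) x) = x from ?_)
    filter_upwards [h] with x hx
    exact (Equiv.symm_apply_eq _).2 hx.symm

/-- The number `μ (α⁻¹(A) ∆ B)`, which depends only on the class of `α`. -/
def AutMP.measureSymmDiff (μ : Measure X) (A B : Set X) : AutMP μ → ℝ≥0∞ :=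
  Quotient.lift (fun e : mpPerm μ => μ (((e : Equiv.Perm X) ⁻¹' A) ∆ B)) (by
    intro a b hab
    have h := (AutMP.mk_eq_mk_iff μ a b).1 (Quotient.sound hab)
    refine measure_congr ?_
    filter_upwards [h] with x hx
    have hA : (((a : Equiv.Perm X) ⁻¹' A) x) = (((b : Equiv.Perm X) ⁻¹' A) x) :=
      congrArg A hx
    exact congrArg (fun p : Prop => (p ∧ ¬ B x) ∨ (B x ∧ ¬ p)) hA)

/-- The usual (weak) topology on `Aut_mp(X, μ)`: the coarsest one for which
`α ↦ μ (α⁻¹(A) ∆ B)` is continuous for all measurable `A` and `B`. A net `αᵢ` converges to `α`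
exactly when `μ (αᵢ⁻¹(A) ∆ α⁻¹(A)) → 0` for every measurable set `A`. -/
instance AutMP.instTopologicalSpace (μ : Measure X) : TopologicalSpace (AutMP μ) :=
  ⨅ (A : {A : Set X // MeasurableSet A}) (B : {B : Set X // MeasurableSet B}),
    TopologicalSpace.induced (AutMP.measureSymmDiff μ A.1 B.1) inferInstance

/-- The homomorphism `Λ → Aut_mp(X, μ)` given by a measure preserving action of `Λ`. -/
def AutMP.ofAction (Λ : Type*) [Group Λ] [MulAction Λ X] [MeasurableConstSMul Λ X]
    (μ : Measure X) [SMulInvariantMeasure Λ X μ] : Λ →* AutMP μ :=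
  (AutMP.mk μ).comp ((MulAction.toPermHom Λ X).codRestrict (mpPerm μ)
    fun g => ⟨measurePreserving_smul g μ, measurePreserving_smul g⁻¹ μ⟩)

end Automorphisms

/-- A topological group `G` is a centralizer group if it is Polish and there is an ergodic
probability measure preserving action of a countable group `Λ` on a standard probability space
`(X, μ)` such that `G` is isomorphic, as a topological group, with the centralizer of `Λ` inside
`Aut_mp(X, μ)`. -/
def IsCentralizerGroup (G : Type*) [Group G] [TopologicalSpace G] : Prop :=
  IsTopologicalGroup G ∧ PolishSpace G ∧
    ∃ (X : Type) (_ : MeasurableSpace X) (_ : StandardBorelSpace X)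
      (μ : Measure X) (_ : IsProbabilityMeasure μ)
      (Λ : Type) (_ : Group Λ) (_ : Countable Λ)
      (_ : MulAction Λ X) (_ : MeasurableConstSMul Λ X) (_ : ErgodicSMul Λ X μ),
      Nonempty (G ≃ₜ* Subgroup.centralizer ((AutMP.ofAction Λ μ).range : Set (AutMP μ)))

/-
A closed subgroup `G` of `S_∞` is the automorphism group of a countable unary algebra
`(J, (q i)ᵢ)`: take for `J` the natural numbers together with the `G`-orbits of the tuples
`(0, …, n)`, and for the operations the maps that send a tuple to one of its entries.

The automorphism group of any countable unary algebra is the centralizer of a countable group acting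
on the compact group `J → Cantor` with its Haar measure. The permutations of the first digits,
applied diagonally to all coordinates, act ergodically, and only the permutations of the coordinates
commute with them: up to scaling, the Haar measure is the only invariant finite measure that does
not charge the diagonals `x e = x e'`, so the graph of an equivariant map into `Cantor` charges some
diagonal, that is, the map is a coordinate. Finally, a permutation of the coordinates commutes with
the shear `x j ↦ x j + shift (x (q i j))` exactly when it commutes with `q i`.
-/

open Filter Topology

section Measures

variable {X : Type*} [MeasurableSpace X]

theorem measurePreserving_restrict_of_preimage_ae_eq {μ : Measure X} {f : X → X}
    (hf : MeasurePreserving f μ μ) {s : Set X} (hs : MeasurableSet s) (h : f ⁻¹' s =ᵐ[μ] s) :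
    MeasurePreserving f (μ.restrict s) (μ.restrict s) := by
  have hrestrict := hf.restrict_preimage hs
  rwa [Measure.restrict_congr_set h] at hrestrict

theorem exists_restrict_eq_smul_count [Countable X] [MeasurableSingletonClass X] {m : Measure X}
    {s : Set X} (h : ∀ a ∈ s, ∀ b ∈ s, m {a} = m {b}) :
    ∃ c : ℝ≥0∞, m.restrict s = c • Measure.count.restrict s := by
  rcases s.eq_empty_or_nonempty with rfl | ⟨a, ha⟩
  · exact ⟨0, by simp⟩
  refine ⟨m {a}, Measure.ext_of_singleton fun b => ?_⟩
  rw [Measure.smul_apply, Measure.restrict_apply (measurableSet_singleton b),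
    Measure.restrict_apply (measurableSet_singleton b)]
  by_cases hb : b ∈ s
  · rw [Set.inter_eq_left.2 (Set.singleton_subset_iff.2 hb), Measure.count_singleton, smul_eq_mul,
      mul_one, h b hb a ha]
  · simp [Set.singleton_inter_eq_empty.2 hb]

end Measures

/-- The Cantor group `(ℤ/2)^ℕ`, whose elements are viewed as sequences of digits. -/
abbrev Cantor : Type := ℕ → ZMod 2

namespace Cantor

/-- The word formed by the first `N` digits. -/
def take (N : ℕ) (x : Cantor) : Fin N → ZMod 2 := fun i => x i

theorem take_apply (N : ℕ) (x : Cantor) (i : Fin N) : x.take N i = x i := rfl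

theorem eventually_take_ne {x y : Cantor} (h : x ≠ y) : ∀ᶠ N in atTop, x.take N ≠ y.take N := by
  obtain ⟨n, hn⟩ := Function.ne_iff.1 h
  filter_upwards [eventually_gt_atTop n] with N hN heq using hn (congrFun heq ⟨n, hN⟩)

theorem take_eq_take_of_le {N M : ℕ} (hNM : N ≤ M) {x y : Cantor} (h : x.take M = y.take M) :
    x.take N = y.take N :=
  funext fun i => congrFun h (Fin.castLE hNM i)

theorem take_dite {N : ℕ} (w : Fin N → ZMod 2) (x : Cantor) :
    take N (fun n => if h : n < N then w ⟨n, h⟩ else x n) = w := by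
  funext i
  simp [take]

end Cantor

/-- The permutation of the Cantor group that applies `g` to the word formed by the first `N`
digits and keeps the other digits. -/
def prefixPerm (N : ℕ) (g : Equiv.Perm (Fin N → ZMod 2)) : Equiv.Perm Cantor where
  toFun x n := if h : n < N then g (x.take N) ⟨n, h⟩ else x n
  invFun x n := if h : n < N then g.symm (x.take N) ⟨n, h⟩ else x n
  left_inv x := by
    funext n
    by_cases h : n < N <;> simp [h, Cantor.take_dite, Cantor.take_apply]
  right_inv x := by
    funext n
    by_cases h : n < N <;> simp [h, Cantor.take_dite, Cantor.take_apply]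

theorem prefixPerm_symm (N : ℕ) (g : Equiv.Perm (Fin N → ZMod 2)) :
    (prefixPerm N g).symm = prefixPerm N g.symm := rfl

theorem take_prefixPerm (N : ℕ) (g : Equiv.Perm (Fin N → ZMod 2)) (x : Cantor) :
    (prefixPerm N g x).take N = g (x.take N) :=
  Cantor.take_dite _ x

theorem take_prefixPerm_eq_of_take_eq {N M : ℕ} (hNM : N ≤ M) (g : Equiv.Perm (Fin N → ZMod 2))
    {x y : Cantor} (h : x.take M = y.take M) :
    (prefixPerm N g x).take M = (prefixPerm N g y).take M := by
  funext i
  have hi : x i = y i := congrFun h i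
  have htake := Cantor.take_eq_take_of_le hNM h
  simp [prefixPerm, Cantor.take_apply, htake, hi]

theorem take_prefixPerm_eq_iff {N M : ℕ} (hNM : N ≤ M) (g : Equiv.Perm (Fin N → ZMod 2))
    {x y : Cantor} :
    (prefixPerm N g x).take M = (prefixPerm N g y).take M ↔ x.take M = y.take M := by
  refine ⟨fun h => ?_, take_prefixPerm_eq_of_take_eq hNM g⟩
  simpa [← prefixPerm_symm] using take_prefixPerm_eq_of_take_eq hNM g.symm h

theorem measurable_prefixPerm (N : ℕ) (g : Equiv.Perm (Fin N → ZMod 2)) :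
    Measurable (prefixPerm N g) := by
  have htake : Measurable (Cantor.take N) :=
    measurable_pi_lambda _ fun i => measurable_pi_apply (i : ℕ)
  refine measurable_pi_lambda _ fun n => ?_
  by_cases h : n < N
  · simpa [prefixPerm, h, Function.comp_def] using
      (measurable_pi_apply (⟨n, h⟩ : Fin N)).comp ((measurable_of_finite g).comp htake)
  · simpa [prefixPerm, h] using measurable_pi_apply n

section Prefixes

variable {E : Type*}

/-- The diagonal action of a prefix permutation on a power of the Cantor group. -/
def diagPerm (E : Type*) (N : ℕ) (g : Equiv.Perm (Fin N → ZMod 2)) : Equiv.Perm (E → Cantor) :=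
  Equiv.piCongrRight fun _ => prefixPerm N g

theorem diagPerm_apply (N : ℕ) (g : Equiv.Perm (Fin N → ZMod 2)) (x : E → Cantor) (e : E) :
    diagPerm E N g x e = prefixPerm N g (x e) := rfl

theorem measurable_diagPerm (N : ℕ) (g : Equiv.Perm (Fin N → ZMod 2)) :
    Measurable (diagPerm E N g) :=
  measurable_pi_lambda _ fun e => (measurable_prefixPerm N g).comp (measurable_pi_apply e)

/-- The words formed by the first `N` digits of the coordinates in `S`. -/
def prefixes (S : Finset E) (N : ℕ) (x : E → Cantor) : S → Fin N → ZMod 2 :=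
  fun e => (x e).take N

theorem measurable_prefixes (S : Finset E) (N : ℕ) : Measurable (prefixes S N) :=
  measurable_pi_lambda _ fun e => measurable_pi_lambda _ fun i =>
    (measurable_pi_apply (i : ℕ)).comp (measurable_pi_apply (e : E))

theorem prefixes_surjective (S : Finset E) (N : ℕ) : Function.Surjective (prefixes S N) := by
  intro a
  refine ⟨Function.extend Subtype.val (fun e => Function.extend Fin.val (a e) 0) 0, ?_⟩
  funext e i
  simp [prefixes, Cantor.take, Fin.val_injective.extend_apply]

theorem prefixes_diagPerm (S : Finset E) (N : ℕ) (g : Equiv.Perm (Fin N → ZMod 2))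
    (x : E → Cantor) : prefixes S N (diagPerm E N g x) = g ∘ prefixes S N x :=
  funext fun e => take_prefixPerm N g (x e)

theorem prefixes_diagPerm_eq_iff (S : Finset E) {N M : ℕ} (hNM : N ≤ M)
    (g : Equiv.Perm (Fin N → ZMod 2)) {x y : E → Cantor} :
    prefixes S M (diagPerm E N g x) = prefixes S M (diagPerm E N g y) ↔
      prefixes S M x = prefixes S M y := by
  simp only [funext_iff (f := prefixes S M _)]
  exact forall_congr' fun e => take_prefixPerm_eq_iff hNM g

theorem eventually_injective_prefixes (S : Finset E) {x : E → Cantor}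
    (hx : Set.InjOn x (S : Set E)) : ∀ᶠ N in atTop, (prefixes S N x).Injective := by
  have hne : ∀ᶠ N in atTop, ∀ e e' : S, e ≠ e' → prefixes S N x e ≠ prefixes S N x e' :=
    eventually_all.2 fun e => eventually_all.2 fun e' => eventually_imp_distrib_left.2 fun h =>
      Cantor.eventually_take_ne fun hxe => h (Subtype.ext (hx e.2 e'.2 hxe))
  filter_upwards [hne] with N hN e e' h
  exact by_contra fun hee' => hN e e' hee' h

theorem monotone_comap_prefixes :
    Monotone fun p : Finset E × ℕ =>
      MeasurableSpace.comap (prefixes (E := E) p.1 p.2) inferInstance := by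
  rintro ⟨S, N⟩ ⟨T, M⟩ ⟨hST, hNM⟩
  let r (a : T → Fin M → ZMod 2) : S → Fin N → ZMod 2 :=
    fun e i => a ⟨e, hST e.2⟩ (Fin.castLE hNM i)
  exact ((measurable_of_finite r).comp (comap_measurable (prefixes T M))).comap_le

theorem iSup_comap_prefixes :
    ⨆ p : Finset E × ℕ, MeasurableSpace.comap (prefixes (E := E) p.1 p.2) inferInstance =
      MeasurableSpace.pi := by
  refine le_antisymm (iSup_le fun p => (measurable_prefixes p.1 p.2).comap_le) ?_
  refine iSup_le fun e => MeasurableSpace.comap_le_iff_le_map.2 (iSup_le fun n => ?_)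
  refine MeasurableSpace.comap_le_iff_le_map.2 fun s _ => ?_
  refine (le_iSup (fun p : Finset E × ℕ => MeasurableSpace.comap (prefixes (E := E) p.1 p.2)
    inferInstance) ({e}, n + 1)) _ ?_
  exact ⟨{a | a ⟨e, Finset.mem_singleton_self e⟩ (Fin.last n) ∈ s},
    Set.toFinite _ |>.measurableSet, rfl⟩

theorem measure_ext_of_map_prefixes {m m' : Measure (E → Cantor)} [IsFiniteMeasure m]
    (h : ∀ S : Finset E, ∀ᶠ N in atTop, m.map (prefixes S N) = m'.map (prefixes S N)) :
    m = m' := by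
  classical
  let 𝓕 (p : Finset E × ℕ) : MeasurableSpace (E → Cantor) :=
    MeasurableSpace.comap (prefixes p.1 p.2) inferInstance
  have heq : ∀ (p : Finset E × ℕ) (B : Set (E → Cantor)), MeasurableSet[𝓕 p] B → m B = m' B := by
    rintro ⟨S, N⟩ B hB
    obtain ⟨M, hM, hNM⟩ := ((h S).and (eventually_ge_atTop N)).exists
    obtain ⟨b, hb, rfl⟩ := monotone_comap_prefixes (show (S, N) ≤ (S, M) from ⟨le_rfl, hNM⟩) B hB
    rw [← Measure.map_apply (measurable_prefixes S M) hb, hM,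
      Measure.map_apply (measurable_prefixes S M) hb]
  refine ext_of_generate_finite (⋃ p, {B | MeasurableSet[𝓕 p] B}) ?_ ?_ ?_
    (heq (∅, 0) Set.univ MeasurableSet.univ)
  · exact iSup_comap_prefixes.symm.trans (MeasurableSpace.generateFrom_iUnion_measurableSet 𝓕).symm
  · exact isPiSystem_iUnion_of_monotone _
      (fun p => @MeasurableSpace.isPiSystem_measurableSet _ (𝓕 p)) monotone_comap_prefixes
  · intro B hB
    obtain ⟨p, hp⟩ := Set.mem_iUnion.1 hB
    exact heq p B hp

end Prefixes

section DiagInvariant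

variable {E : Type*} {m m' : Measure (E → Cantor)}

/-- Invariance of a measure on a power of the Cantor group under the diagonal action of all
prefix permutations. -/
def DiagInvariant (m : Measure (E → Cantor)) : Prop :=
  ∀ N g, MeasurePreserving (diagPerm E N g) m m

namespace DiagInvariant

theorem restrict (hm : DiagInvariant m) {s : Set (E → Cantor)} (hs : MeasurableSet s)
    (h : ∀ N g, diagPerm E N g ⁻¹' s =ᵐ[m] s) : DiagInvariant (m.restrict s) :=
  fun N g => measurePreserving_restrict_of_preimage_ae_eq (hm N g) hs (h N g)

theorem map {F : Type*} (hm : DiagInvariant m) {H : (E → Cantor) → F → Cantor} (hH : Measurable H)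
    (h : ∀ N g, H ∘ diagPerm E N g =ᵐ[m] diagPerm F N g ∘ H) : DiagInvariant (m.map H) := by
  refine fun N g => ⟨measurable_diagPerm N g, ?_⟩
  rw [Measure.map_map (measurable_diagPerm N g) hH, ← Measure.map_congr (h N g),
    ← Measure.map_map hH (measurable_diagPerm N g), (hm N g).map_eq]

theorem map_prefixes_singleton_eq (hm : DiagInvariant m) (S : Finset E) (N : ℕ)
    {a b : S → Fin N → ZMod 2} (ha : a.Injective) (hb : b.Injective) :
    m.map (prefixes S N) {a} = m.map (prefixes S N) {b} := by
  obtain ⟨g, hg⟩ := Equiv.Perm.exists_extending_pair a b ha hb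
  have hgab : g ∘ a = b := funext hg
  rw [Measure.map_apply (measurable_prefixes S N) (measurableSet_singleton a),
    Measure.map_apply (measurable_prefixes S N) (measurableSet_singleton b),
    ← (hm N g).measure_preimage
      (measurable_prefixes S N (measurableSet_singleton b)).nullMeasurableSet]
  congr 1
  ext x
  simp only [Set.mem_preimage, Set.mem_singleton_iff, prefixes_diagPerm, ← hgab,
    g.injective.comp_left.eq_iff]

theorem exists_measure_preimage_prefixes_inter_injective (hm : DiagInvariant m) (S : Finset E)
    (N : ℕ) :
    ∃ c : ℝ≥0∞, ∀ b : Set (S → Fin N → ZMod 2),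
      m (prefixes S N ⁻¹' (b ∩ {a | a.Injective})) =
        c * Measure.count (b ∩ {a | a.Injective}) := by
  obtain ⟨c, hc⟩ := exists_restrict_eq_smul_count (s := {a : S → Fin N → ZMod 2 | a.Injective})
    fun _ ha _ hb => hm.map_prefixes_singleton_eq S N ha hb
  refine ⟨c, fun b => ?_⟩
  have hb := congrArg (fun ν => ν b) hc
  simpa only [Measure.smul_apply, smul_eq_mul, Measure.restrict_apply b.toFinite.measurableSet,
    Measure.map_apply (measurable_prefixes S N) (Set.toFinite _).measurableSet] using hb

theorem measure_inter_injective_mul (hm : DiagInvariant m) (hm' : DiagInvariant m') (S : Finset E)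
    {N M : ℕ} (hNM : N ≤ M) (b : Set (S → Fin N → ZMod 2)) :
    m' {x | (prefixes S M x).Injective} *
        m (prefixes S N ⁻¹' b ∩ {x | (prefixes S M x).Injective}) =
      m {x | (prefixes S M x).Injective} *
        m' (prefixes S N ⁻¹' b ∩ {x | (prefixes S M x).Injective}) := by
  obtain ⟨c, hc⟩ := hm.exists_measure_preimage_prefixes_inter_injective S M
  obtain ⟨c', hc'⟩ := hm'.exists_measure_preimage_prefixes_inter_injective S M
  let b' : Set (S → Fin M → ZMod 2) := {a | (fun e i => a e (Fin.castLE hNM i)) ∈ b}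
  have hb' : prefixes S N ⁻¹' b ∩ {x : E → Cantor | (prefixes S M x).Injective} =
      prefixes S M ⁻¹' (b' ∩ {a | a.Injective}) := rfl
  have huniv : {x : E → Cantor | (prefixes S M x).Injective} =
      prefixes S M ⁻¹' (Set.univ ∩ {a | a.Injective}) := by rw [Set.univ_inter]; rfl
  rw [hb', huniv, hc, hc, hc', hc']
  ring

end DiagInvariant

theorem tendsto_measure_inter_injective_prefixes [IsFiniteMeasure m]
    (hd : Pairwise fun e e' => m {x | x e = x e'} = 0) (S : Finset E) {B : Set (E → Cantor)}
    (hB : MeasurableSet B) :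
    Tendsto (fun N => m (B ∩ {x | (prefixes S N x).Injective})) atTop (𝓝 (m B)) := by
  refine tendsto_measure_of_ae_tendsto_indicator_of_isFiniteMeasure atTop hB
    (fun N => hB.inter (measurableSet_preimage (measurable_prefixes S N)
      (Set.toFinite {a : S → Fin N → ZMod 2 | a.Injective}).measurableSet)) ?_
  have hinj : ∀ᵐ x ∂m, ∀ e e' : S, e ≠ e' → x e ≠ x e' :=
    ae_all_iff.2 fun e => ae_all_iff.2 fun e' => eventually_imp_distrib_left.2 fun h =>
      measure_eq_zero_iff_ae_notMem.1 (hd (Subtype.coe_injective.ne h))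
  filter_upwards [hinj] with x hx
  have hxS : Set.InjOn x (S : Set E) := fun e he e' he' h =>
    by_contra fun hee' => hx ⟨e, he⟩ ⟨e', he'⟩ (fun h' => hee' (congrArg Subtype.val h')) h
  filter_upwards [eventually_injective_prefixes S hxS] with N hN
  exact and_iff_left hN

theorem DiagInvariant.smul_eq_smul [IsFiniteMeasure m] [IsFiniteMeasure m']
    (hm : DiagInvariant m) (hm' : DiagInvariant m')
    (hd : Pairwise fun e e' => m {x | x e = x e'} = 0)
    (hd' : Pairwise fun e e' => m' {x | x e = x e'} = 0) :
    m' Set.univ • m = m Set.univ • m' := by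
  have : IsFiniteMeasure (m' Set.univ • m) := m.smul_finite (measure_ne_top m' _)
  refine measure_ext_of_map_prefixes fun S => Eventually.of_forall fun N =>
    Measure.ext fun b hb => ?_
  have hB := measurable_prefixes S N hb
  rw [Measure.map_apply (measurable_prefixes S N) hb,
    Measure.map_apply (measurable_prefixes S N) hb, Measure.smul_apply, Measure.smul_apply,
    smul_eq_mul, smul_eq_mul]
  have hlim : ∀ (m m' : Measure (E → Cantor)) [IsFiniteMeasure m] [IsFiniteMeasure m'],
      (Pairwise fun e e' => m {x | x e = x e'} = 0) →
      (Pairwise fun e e' => m' {x | x e = x e'} = 0) →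
      Tendsto (fun M => m' {x | (prefixes S M x).Injective} *
        m (prefixes S N ⁻¹' b ∩ {x | (prefixes S M x).Injective})) atTop
        (𝓝 (m' Set.univ * m (prefixes S N ⁻¹' b))) := by
    intro m m' _ _ hd hd'
    have huniv := tendsto_measure_inter_injective_prefixes hd' S MeasurableSet.univ
    simp only [Set.univ_inter] at huniv
    exact ENNReal.Tendsto.mul huniv (Or.inr (measure_ne_top m _))
      (tendsto_measure_inter_injective_prefixes hd S hB) (Or.inr (measure_ne_top m' _))
  refine tendsto_nhds_unique ((hlim m m' hd hd').congr' ?_) (hlim m' m hd' hd)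
  filter_upwards [eventually_ge_atTop N] with M hNM
  exact hm.measure_inter_injective_mul hm' S hNM b

end DiagInvariant

section ConsValue

variable {E : Type*} {F : (E → Cantor) → Cantor}

/-- The map `x ↦ (F x, x)`, with `F x` placed in the coordinate `none`; it turns equivariance of
`F` into invariance of an image measure. -/
def consValue (F : (E → Cantor) → Cantor) (x : E → Cantor) : Option E → Cantor :=
  fun o => o.elim (F x) x

theorem measurable_consValue (hF : Measurable F) : Measurable (consValue F) :=
  measurable_pi_lambda _ fun o => match o with
    | none => hF
    | some e => measurable_pi_apply e

theorem measurable_comp_some : Measurable fun y : Option E → Cantor => y ∘ some :=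
  measurable_pi_lambda _ fun e => measurable_pi_apply (some e)

theorem diagInvariant_map_consValue {m : Measure (E → Cantor)} (hm : DiagInvariant m)
    (hF : Measurable F) (h : ∀ N g, F ∘ diagPerm E N g =ᵐ[m] prefixPerm N g ∘ F) :
    DiagInvariant (m.map (consValue F)) := by
  refine hm.map (measurable_consValue hF) fun N g => ?_
  filter_upwards [h N g] with x hx
  funext o
  cases o with
  | none => exact hx
  | some e => rfl

theorem pairwise_map_consValue_diagonal_eq_zero {m : Measure (E → Cantor)} (hF : Measurable F)
    (hm : Pairwise fun e e' => m {x | x e = x e'} = 0) (hne : ∀ᵐ x ∂m, ∀ e, F x ≠ x e) :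
    Pairwise fun o o' => m.map (consValue F) {x | x o = x o'} = 0 := by
  intro o o' hoo'
  rw [Measure.map_apply (measurable_consValue hF)
    (measurableSet_eq_fun (measurable_pi_apply o) (measurable_pi_apply o')),
    measure_eq_zero_iff_ae_notMem]
  match o, o', hoo' with
  | none, none, h => exact absurd rfl h
  | none, some e, _ => filter_upwards [hne] with x hx using hx e
  | some e, none, _ => filter_upwards [hne] with x hx using (hx e).symm
  | some e, some e', h =>
    exact measure_eq_zero_iff_ae_notMem.1 (hm fun h' => h (congrArg some h'))

end ConsValue

section CantorHaar

variable {E : Type*} [Countable E]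

/-- The Haar probability measure on a countable power of the Cantor group. -/
noncomputable def cantorHaar (E : Type*) [Countable E] : Measure (E → Cantor) :=
  Measure.addHaarMeasure ⊤

instance : (cantorHaar E).IsAddHaarMeasure :=
  inferInstanceAs (Measure.addHaarMeasure ⊤).IsAddHaarMeasure

instance : (cantorHaar E).Regular :=
  inferInstanceAs (Measure.addHaarMeasure ⊤).Regular

instance : IsProbabilityMeasure (cantorHaar E) where
  measure_univ := by
    simpa [cantorHaar] using
      Measure.addHaarMeasure_self (K₀ := (⊤ : TopologicalSpace.PositiveCompacts (E → Cantor)))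

theorem measurePreserving_cantorHaar {F : Type*} [Countable F] (f : (E → Cantor) →+ (F → Cantor))
    (hf : Continuous f) (hs : Function.Surjective f) :
    MeasurePreserving f (cantorHaar E) (cantorHaar F) :=
  AddMonoidHom.measurePreserving hf hs (by simp)

theorem cantorHaar_prefixes_eq (S : Finset E) (N : ℕ) (x y : E → Cantor) :
    cantorHaar E {z | prefixes S N z = prefixes S N x} =
      cantorHaar E {z | prefixes S N z = prefixes S N y} := by
  rw [← measure_preimage_add (cantorHaar E) (y - x) {z | prefixes S N z = prefixes S N y}]
  congr 1
  ext z
  have hadd : prefixes S N (y - x + z) = prefixes S N y + (prefixes S N z - prefixes S N x) :=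
    (congrArg (prefixes S N) (sub_add_eq_add_sub y x z)).trans
      (add_sub_assoc (prefixes S N y) (prefixes S N z) (prefixes S N x))
  simp only [Set.mem_preimage, Set.mem_ofPred_eq, hadd, add_eq_left, sub_eq_zero]

theorem diagInvariant_cantorHaar : DiagInvariant (cantorHaar E) := by
  refine fun N g => ⟨measurable_diagPerm N g, ?_⟩
  have := Measure.isFiniteMeasure_map (cantorHaar E) (diagPerm E N g)
  refine measure_ext_of_map_prefixes fun S => ?_
  filter_upwards [eventually_ge_atTop N] with M hNM
  refine Measure.ext_of_singleton fun b => ?_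
  obtain ⟨y, rfl⟩ := ((prefixes_surjective S M).comp (diagPerm E N g).surjective) b
  have hsingleton := measurableSet_singleton (prefixes S M (diagPerm E N g y))
  rw [Function.comp_apply, Measure.map_apply (measurable_prefixes S M) hsingleton,
    Measure.map_apply (measurable_diagPerm N g) (measurable_prefixes S M hsingleton),
    Measure.map_apply (measurable_prefixes S M) hsingleton]
  calc cantorHaar E {z | prefixes S M (diagPerm E N g z) = prefixes S M (diagPerm E N g y)}
      = cantorHaar E {z | prefixes S M z = prefixes S M y} := by
        simp only [prefixes_diagPerm_eq_iff S hNM g]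
    _ = cantorHaar E {z | prefixes S M z = prefixes S M (diagPerm E N g y)} :=
        cantorHaar_prefixes_eq S M y _

-- The translates of the graph by different vectors in the direction `e` are disjoint.
theorem cantorHaar_graph_eq_zero {e : E} {F : (E → Cantor) → Cantor} (hF : Measurable F)
    (hFe : DependsOn F {e}ᶜ) : cantorHaar E {x | x e = F x} = 0 := by
  classical
  let graph : Set (E → Cantor) := {x | x e = F x}
  have hmeas : MeasurableSet graph := measurableSet_eq_fun (measurable_pi_apply e) hF
  let v (n : ℕ) : E → Cantor := Pi.single e (Pi.single n 1)
  have hmem : ∀ n x, v n + x ∈ graph ↔ Pi.single n 1 + x e = F x := by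
    intro n x
    have hFv : F (v n + x) = F x := hFe fun e' he' => by
      simp [v, Pi.single_eq_of_ne (Set.mem_compl_singleton_iff.1 he')]
    simp [graph, hFv, v]
  have hdisjoint : Pairwise (Function.onFun Disjoint fun n => (v n + ·) ⁻¹' graph) := by
    intro n k hnk
    refine Set.disjoint_left.2 fun x hn hk => ?_
    have heq := add_right_cancel (((hmem n x).1 hn).trans ((hmem k x).1 hk).symm)
    simpa [hnk] using congrFun heq n
  by_contra hne
  have hsum := measure_iUnion (μ := cantorHaar E) hdisjoint
    fun n => hmeas.preimage (measurable_const_add (v n))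
  simp only [measure_preimage_add] at hsum
  rw [ENNReal.tsum_const_eq_top_of_ne_zero hne] at hsum
  exact measure_ne_top _ _ hsum

theorem cantorHaar_diagonal_eq_zero {e e' : E} (h : e ≠ e') :
    cantorHaar E {x | x e = x e'} = 0 :=
  cantorHaar_graph_eq_zero (measurable_pi_apply e') fun _ _ hxy => hxy e' h.symm

theorem eq_of_ae_eq_coord {e e' : E} (h : ∀ᵐ x ∂cantorHaar E, x e = x e') : e = e' := by
  by_contra hne
  obtain ⟨x, hx, hx'⟩ :=
    (h.and (measure_eq_zero_iff_ae_notMem.1 (cantorHaar_diagonal_eq_zero hne))).exists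
  exact hx' hx

theorem DiagInvariant.eq_smul_cantorHaar {m : Measure (E → Cantor)} [IsFiniteMeasure m]
    (hm : DiagInvariant m) (hd : Pairwise fun e e' => m {x | x e = x e'} = 0) :
    m = m Set.univ • cantorHaar E := by
  simpa using hm.smul_eq_smul diagInvariant_cantorHaar hd fun _ _ => cantorHaar_diagonal_eq_zero

theorem eventuallyConst_of_diagPerm_preimage_ae_eq {s : Set (E → Cantor)} (hs : MeasurableSet s)
    (h : ∀ N g, diagPerm E N g ⁻¹' s =ᵐ[cantorHaar E] s) :
    EventuallyConst s (ae (cantorHaar E)) := by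
  have heq := (diagInvariant_cantorHaar.restrict hs h).eq_smul_cantorHaar fun _ _ he =>
    Measure.absolutelyContinuous_of_le Measure.restrict_le_self (cantorHaar_diagonal_eq_zero he)
  have hcompl : cantorHaar E s * cantorHaar E sᶜ = 0 := by
    simpa [Measure.restrict_apply hs.compl] using
      (congrArg (fun ν : Measure (E → Cantor) => ν sᶜ) heq).symm
  rw [eventuallyConst_set', ae_eq_empty, ae_eq_univ]
  exact mul_eq_zero.1 hcompl

variable {F : (E → Cantor) → Cantor}

theorem cantorHaar_option_graph_eq_zero (hF : Measurable F) :
    cantorHaar (Option E) {y | y none = F (y ∘ some)} = 0 :=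
  cantorHaar_graph_eq_zero (hF.comp measurable_comp_some) fun _ _ hxy =>
    congrArg F (funext fun e => hxy (some e) (Option.some_ne_none e))

/-
If `F` avoided all coordinates on a set `W` of positive measure, then the image of the measure on
`W` under `x ↦ (F x, x)` would be a multiple of the Haar measure, although it lives on the graph
of `F`.
-/
theorem cantorHaar_forall_ne_coord_eq_zero (hF : Measurable F)
    (h : ∀ N g, F ∘ diagPerm E N g =ᵐ[cantorHaar E] prefixPerm N g ∘ F) :
    cantorHaar E {x | ∀ e, F x ≠ x e} = 0 := by
  set W : Set (E → Cantor) := {x | ∀ e, F x ≠ x e}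
  have hW : MeasurableSet W := by
    simp only [W, Set.ofPred_forall]
    exact MeasurableSet.iInter fun e => (measurableSet_eq_fun hF (measurable_pi_apply e)).compl
  have hWinv : ∀ N g, diagPerm E N g ⁻¹' W =ᵐ[cantorHaar E] W := by
    refine fun N g => eventuallyEq_set.2 ?_
    filter_upwards [h N g] with x hx
    simp only [Function.comp_apply] at hx
    simp [W, hx, diagPerm_apply]
  have hle : (cantorHaar E).restrict W ≪ cantorHaar E :=
    Measure.absolutelyContinuous_of_le Measure.restrict_le_self
  have hm := diagInvariant_map_consValue (diagInvariant_cantorHaar.restrict hW hWinv) hF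
    fun N g => hle.ae_eq (h N g)
  have hd := pairwise_map_consValue_diagonal_eq_zero hF
    (fun _ _ he => hle (cantorHaar_diagonal_eq_zero he)) (ae_restrict_mem hW)
  have := Measure.isFiniteMeasure_map ((cantorHaar E).restrict W) (consValue F)
  have heq := hm.eq_smul_cantorHaar hd
  have hmeas : MeasurableSet {y : Option E → Cantor | y none = F (y ∘ some)} :=
    measurableSet_eq_fun (measurable_pi_apply none) (hF.comp measurable_comp_some)
  have hgraph := congrArg (fun ν => ν {y | y none = F (y ∘ some)}) heq
  rw [Measure.map_apply (measurable_consValue hF) hmeas, Measure.smul_apply,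
    cantorHaar_option_graph_eq_zero hF, smul_zero] at hgraph
  have huniv : consValue F ⁻¹' {y | y none = F (y ∘ some)} = Set.univ :=
    Set.eq_univ_of_forall fun _ => rfl
  rwa [huniv, Measure.restrict_apply_univ] at hgraph

theorem exists_ae_eq_coord_of_equivariant (hF : Measurable F)
    (h : ∀ N g, F ∘ diagPerm E N g =ᵐ[cantorHaar E] prefixPerm N g ∘ F) :
    ∃ e, ∀ᵐ x ∂cantorHaar E, F x = x e := by
  have hcoord : ∃ e, ¬ ∀ᵐ x ∂cantorHaar E, F x ≠ x e := by
    by_contra! hall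
    obtain ⟨x, hx, hx'⟩ := ((ae_all_iff.2 hall).and (measure_eq_zero_iff_ae_notMem.1
      (cantorHaar_forall_ne_coord_eq_zero hF h))).exists
    exact hx' hx
  obtain ⟨e, he⟩ := hcoord
  have hconst : EventuallyConst {x | F x = x e} (ae (cantorHaar E)) := by
    refine eventuallyConst_of_diagPerm_preimage_ae_eq
      (measurableSet_eq_fun hF (measurable_pi_apply e)) fun N g => eventuallyEq_set.2 ?_
    filter_upwards [h N g] with x hx
    simp only [Function.comp_apply] at hx
    simp [hx, diagPerm_apply]
  rcases eventuallyConst_set.1 hconst with hae | hae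
  · exact ⟨e, hae⟩
  · exact absurd hae he

end CantorHaar

section DiscreteEvaluation

theorem continuous_eval_of_discrete {α β : Type*} [TopologicalSpace α] [DiscreteTopology α]
    [TopologicalSpace β] : Continuous fun p : (α → β) × α => p.1 p.2 :=
  continuous_prod_of_discrete_right.2 fun a => continuous_apply a

theorem continuous_comp_of_discrete {α β γ : Type*} [TopologicalSpace β] [DiscreteTopology β]
    [TopologicalSpace γ] : Continuous fun p : (β → γ) × (α → β) => p.1 ∘ p.2 := by
  refine continuous_pi fun a => ?_
  have hpair : Continuous fun p : (β → γ) × (α → β) => (p.1, p.2 a) := by fun_prop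
  exact continuous_eval_of_discrete.comp hpair

theorem continuous_perm_inv_apply {T J : Type*} [TopologicalSpace T] [TopologicalSpace J]
    [DiscreteTopology J] {f : T → Equiv.Perm J} (hf : ∀ j, Continuous fun t => f t j) (j : J) :
    Continuous fun t => (f t)⁻¹ j := by
  refine continuous_discrete_rng.2 fun k => ?_
  have hset : (fun t => (f t)⁻¹ j) ⁻¹' {k} = (fun t => f t k) ⁻¹' {j} :=
    Set.ext fun t => (Equiv.symm_apply_eq (f t)).trans eq_comm
  rw [hset]
  exact (isOpen_discrete {j}).preimage (hf k)

end DiscreteEvaluation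

section WeakTopology

theorem continuous_measure_preimage_symmDiff {T X Y : Type*} [TopologicalSpace T]
    [TopologicalSpace X] [R1Space X] [MeasurableSpace X] [BorelSpace X]
    [TopologicalSpace Y] [R1Space Y] [MeasurableSpace Y] [BorelSpace Y]
    {μ : Measure X} [μ.InnerRegularCompactLTTop] [IsFiniteMeasure μ] {ν : Measure Y}
    [IsLocallyFiniteMeasure ν] {f : T → C(X, Y)} (hf : Continuous f)
    (hfm : ∀ t, MeasurePreserving (f t) μ ν) {A : Set Y} (hA : NullMeasurableSet A ν) (B : Set X) :
    Continuous fun t => μ ((f t ⁻¹' A) ∆ B) := by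
  refine continuous_iff_continuousAt.2 fun t => ?_
  have hνA : ν A ≠ ∞ := (hfm t).measure_preimage hA ▸ measure_ne_top μ _
  have hlim := tendsto_measure_symmDiff_preimage_nhds_zero (hf.tendsto t)
    (Eventually.of_forall hfm) (hfm t) hA hνA
  refine (ENNReal.tendsto_nhds (measure_ne_top _ _)).2 fun ε hε => ?_
  filter_upwards [ENNReal.tendsto_nhds_zero.1 hlim ε hε] with s hs
  constructor
  · rw [tsub_le_iff_left]
    refine (measure_symmDiff_le _ (f s ⁻¹' A) _).trans (add_le_add_left ?_ _)
    rwa [symmDiff_comm]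
  · rw [add_comm]
    exact (measure_symmDiff_le _ (f t ⁻¹' A) _).trans (add_le_add_left hs _)

namespace AutMP

variable {X : Type*} [MeasurableSpace X] {μ : Measure X}

theorem continuous_iff {T : Type*} [TopologicalSpace T] {f : T → AutMP μ} :
    Continuous f ↔ ∀ A B, MeasurableSet A → MeasurableSet B →
      Continuous fun t => measureSymmDiff μ A B (f t) := by
  refine continuous_iInf_rng.trans ?_
  simp only [continuous_iInf_rng, continuous_induced_rng, Subtype.forall]
  exact forall_congr' fun A => forall_comm

theorem commute_mk_iff {a b : mpPerm μ} :
    Commute (mk μ a) (mk μ b) ↔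
      ∀ᵐ x ∂μ, (a : Equiv.Perm X) ((b : Equiv.Perm X) x) =
        (b : Equiv.Perm X) ((a : Equiv.Perm X) x) := by
  rw [commute_iff_eq, ← map_mul, ← map_mul, mk_eq_mk_iff]
  rfl

theorem mk_surjective : Function.Surjective (mk μ) :=
  QuotientGroup.mk'_surjective _

end AutMP

end WeakTopology

section CoordinatePermutations

variable {J : Type*}

/-- The set of points whose coordinate `e` starts with the digit `0`; these sets detect how
a permutation acts on the coordinates. -/
def zeroDigit (e : J) : Set (J → Cantor) := {x | x e 0 = 0}

theorem measurableSet_zeroDigit (e : J) : MeasurableSet (zeroDigit e) :=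
  measurableSet_eq_fun ((measurable_pi_apply 0).comp (measurable_pi_apply e)) measurable_const

/-- The action of the permutations of `J` on `J → Cantor` by permutation of the coordinates. -/
def coordPerm (J : Type*) : Equiv.Perm J →* Equiv.Perm (J → Cantor) where
  toFun ρ := ρ.arrowCongr (Equiv.refl Cantor)
  map_one' := rfl
  map_mul' _ _ := rfl

variable [Countable J]

theorem measurePreserving_coordPerm (ρ : Equiv.Perm J) :
    MeasurePreserving (coordPerm J ρ) (cantorHaar J) (cantorHaar J) :=
  measurePreserving_cantorHaar
    { toFun := coordPerm J ρ, map_zero' := rfl, map_add' := fun _ _ => rfl }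
    (continuous_pi fun j => continuous_apply (ρ⁻¹ j)) (coordPerm J ρ).surjective

/-- The permutations of the coordinates as measure preserving automorphisms of `J → Cantor`. -/
noncomputable def coordAut (J : Type*) [Countable J] : Equiv.Perm J →* AutMP (cantorHaar J) :=
  (AutMP.mk _).comp ((coordPerm J).codRestrict (mpPerm (cantorHaar J))
    fun ρ => ⟨measurePreserving_coordPerm ρ, measurePreserving_coordPerm ρ⁻¹⟩)

theorem coordAut_eq_mk_iff {ρ : Equiv.Perm J} {θ : mpPerm (cantorHaar J)} :
    coordAut J ρ = AutMP.mk _ θ ↔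
      ∀ᵐ x ∂cantorHaar J, x ∘ ⇑ρ⁻¹ = (θ : Equiv.Perm (J → Cantor)) x :=
  AutMP.mk_eq_mk_iff _ _ _

theorem coordAut_injective : Function.Injective (coordAut J) := by
  intro ρ τ h
  refine inv_injective (Equiv.ext fun j => eq_of_ae_eq_coord ?_)
  filter_upwards [(AutMP.mk_eq_mk_iff _ _ _).1 h] with x hx using congrFun hx j

section Embedding

-- If `e ≠ e'`, then changing the first digit of the coordinate `e` maps the symmetric difference
-- onto its complement, so both have measure `1 / 2`.
theorem cantorHaar_zeroDigit_symmDiff_lt_half_iff {e e' : J} :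
    cantorHaar J (zeroDigit e ∆ zeroDigit e') < 1 / 2 ↔ e = e' := by
  classical
  refine ⟨fun hlt => by_contra fun hne => ?_, fun h => by simp [h]⟩
  set D := zeroDigit e ∆ zeroDigit e' with hD
  let v : J → Cantor := Pi.single e (Pi.single 0 1)
  have hflip : (v + ·) ⁻¹' D = Dᶜ := by
    ext x
    have hdigit : ∀ a b : ZMod 2, ((1 + a = 0 ∧ ¬ b = 0) ∨ (b = 0 ∧ ¬ 1 + a = 0)) ↔
        (a = 0 ↔ b = 0) := by decide
    simpa [hD, v, zeroDigit, Set.mem_symmDiff, Ne.symm hne] using hdigit (x e 0) (x e' 0)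
  have hcompl : cantorHaar J Dᶜ = cantorHaar J D := hflip ▸ measure_preimage_add _ v D
  have hsum := measure_add_measure_compl (μ := cantorHaar J)
    ((measurableSet_zeroDigit e).symmDiff (measurableSet_zeroDigit e'))
  rw [← hD, hcompl, measure_univ] at hsum
  exact (ENNReal.add_lt_add hlt hlt).ne (hsum.trans (ENNReal.add_halves 1).symm)

theorem measureSymmDiff_coordAut_zeroDigit_lt_half_iff {ρ : Equiv.Perm J} {j k : J} :
    AutMP.measureSymmDiff _ (zeroDigit k) (zeroDigit j) (coordAut J ρ) < 1 / 2 ↔ ρ j = k := by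
  change cantorHaar J (zeroDigit (ρ⁻¹ k) ∆ zeroDigit j) < 1 / 2 ↔ ρ j = k
  rw [cantorHaar_zeroDigit_symmDiff_lt_half_iff, Equiv.Perm.inv_eq_iff_eq, eq_comm]

variable [TopologicalSpace J] [DiscreteTopology J]

theorem continuous_coordAut_comp_iff {T : Type*} [TopologicalSpace T] {f : T → Equiv.Perm J} :
    (Continuous fun t => coordAut J (f t)) ↔ ∀ j, Continuous fun t => f t j := by
  constructor
  · refine fun hf j => continuous_discrete_rng.2 fun k => ?_
    have hset : (fun t => f t j) ⁻¹' {k} =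
        {t | AutMP.measureSymmDiff _ (zeroDigit k) (zeroDigit j) (coordAut J (f t)) < 1 / 2} :=
      Set.ext fun t => measureSymmDiff_coordAut_zeroDigit_lt_half_iff.symm
    rw [hset]
    exact isOpen_lt (AutMP.continuous_iff.1 hf _ _ (measurableSet_zeroDigit k)
      (measurableSet_zeroDigit j)) continuous_const
  · refine fun hf => AutMP.continuous_iff.2 fun A B hA _ => ?_
    have hjoint : Continuous fun p : T × (J → Cantor) => coordPerm J (f p.1) p.2 :=
      continuous_pi fun j => continuous_eval_of_discrete.comp
        (continuous_snd.prodMk ((continuous_perm_inv_apply hf j).comp continuous_fst))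
    exact continuous_measure_preimage_symmDiff (ContinuousMap.curry ⟨_, hjoint⟩).continuous
      (fun t => measurePreserving_coordPerm (f t)) hA.nullMeasurableSet B

theorem isEmbedding_coordAut_comp {T : Type*} [TopologicalSpace T] {f : T → Equiv.Perm J}
    (hf : IsEmbedding fun t => ⇑(f t)) : IsEmbedding fun t => coordAut J (f t) := by
  let e : Equiv.Perm J ≃* (coordAut J).range := MonoidHom.ofInjective coordAut_injective
  have hcont : Continuous fun t => e (f t) :=
    (continuous_coordAut_comp_iff.2 (continuous_pi_iff.1 hf.continuous)).subtype_mk _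
  have hval : ∀ c, coordAut J (e.symm c) = c := fun c => congrArg Subtype.val (e.apply_symm_apply c)
  have hsymm : Continuous fun c => ⇑(e.symm c) := by
    refine continuous_pi (continuous_coordAut_comp_iff.1 ?_)
    simpa only [hval] using continuous_subtype_val
  refine IsEmbedding.subtypeVal.comp (IsEmbedding.of_comp hcont hsymm ?_)
  simpa only [Function.comp_def, e.symm_apply_apply] using hf

end Embedding

section DiagCentralizer

/-- The diagonal prefix permutations as measure preserving bijections. -/
noncomputable def diagMP (J : Type*) [Countable J] (N : ℕ) (g : Equiv.Perm (Fin N → ZMod 2)) :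
    mpPerm (cantorHaar J) :=
  ⟨diagPerm J N g, diagInvariant_cantorHaar N g, diagInvariant_cantorHaar N g.symm⟩

theorem exists_ae_eq_comp_of_commute_diagMP {θ : mpPerm (cantorHaar J)}
    (h : ∀ N g, Commute (AutMP.mk _ (diagMP J N g)) (AutMP.mk _ θ)) :
    ∃ ρ : J → J, ∀ᵐ x ∂cantorHaar J, (θ : Equiv.Perm (J → Cantor)) x = x ∘ ρ := by
  have hcoord : ∀ j, ∃ i, ∀ᵐ x ∂cantorHaar J, (θ : Equiv.Perm (J → Cantor)) x j = x i := by
    refine fun j => exists_ae_eq_coord_of_equivariant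
      ((measurable_pi_apply j).comp θ.2.1.measurable) fun N g => ?_
    filter_upwards [AutMP.commute_mk_iff.1 (h N g)] with x hx using (congrFun hx j).symm
  choose ρ hρ using hcoord
  exact ⟨ρ, (ae_all_iff.2 hρ).mono fun x hx => funext hx⟩

theorem leftInverse_of_ae_eq_comp {θ : mpPerm (cantorHaar J)} {ρ ρ' : J → J}
    (hρ : ∀ᵐ x ∂cantorHaar J, (θ : Equiv.Perm (J → Cantor)) x = x ∘ ρ)
    (hρ' : ∀ᵐ x ∂cantorHaar J, (↑θ⁻¹ : Equiv.Perm (J → Cantor)) x = x ∘ ρ') :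
    Function.LeftInverse ρ' ρ := by
  refine fun j => eq_of_ae_eq_coord ?_
  filter_upwards [hρ', θ.2.2.quasiMeasurePreserving.ae hρ] with x hx' hx
  have hx'' : (x ∘ ρ') ∘ ρ = x := by
    rw [← hx']
    exact hx.symm.trans ((θ : Equiv.Perm (J → Cantor)).apply_symm_apply x)
  exact congrFun hx'' j

theorem mem_range_coordAut_iff {c : AutMP (cantorHaar J)} :
    c ∈ (coordAut J).range ↔ ∀ N g, Commute (AutMP.mk _ (diagMP J N g)) c := by
  constructor
  · rintro ⟨ρ, rfl⟩ N g
    exact AutMP.commute_mk_iff.2 (Eventually.of_forall fun _ => rfl)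
  · obtain ⟨θ, rfl⟩ := AutMP.mk_surjective c
    intro h
    obtain ⟨ρ, hρ⟩ := exists_ae_eq_comp_of_commute_diagMP h
    obtain ⟨ρ', hρ'⟩ := exists_ae_eq_comp_of_commute_diagMP (θ := θ⁻¹) fun N g =>
      map_inv (AutMP.mk (cantorHaar J)) θ ▸ (h N g).inv_right
    have hleft := leftInverse_of_ae_eq_comp hρ hρ'
    have hright := leftInverse_of_ae_eq_comp hρ' (inv_inv θ ▸ hρ)
    let σ : Equiv.Perm J := ⟨ρ', ρ, hright, hleft⟩
    exact ⟨σ, coordAut_eq_mk_iff.2 (hρ.mono fun x hx => hx.symm)⟩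

end DiagCentralizer

end CoordinatePermutations

section Subgroups

theorem countable_subgroup_closure {Γ : Type*} [Group Γ] {s : Set Γ} (hs : s.Countable) :
    Countable (Subgroup.closure s) := by
  have := hs.to_subtype
  rw [← Subtype.range_coe (s := s), ← FreeGroup.range_lift_eq_closure]
  exact (FreeGroup.lift ((↑) : s → Γ)).rangeRestrict_surjective.countable

theorem nonempty_continuousMulEquiv_of_isEmbedding {H K : Type*} [Group H] [TopologicalSpace H]
    [Group K] [TopologicalSpace K] {f : H →* K} (hf : IsEmbedding f) {L : Subgroup K}
    (hL : f.range = L) : Nonempty (H ≃ₜ* L) := by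
  subst hL
  let e : H ≃* f.range := MonoidHom.ofInjective hf.injective
  refine ⟨{ e with
    continuous_toFun := hf.continuous.subtype_mk _
    continuous_invFun := hf.continuous_iff.2 ?_ }⟩
  have hval : ⇑f ∘ e.symm = Subtype.val :=
    funext fun c => congrArg Subtype.val (e.apply_symm_apply c)
  exact hval ▸ continuous_subtype_val

end Subgroups

section SubgroupActions

variable {X : Type*} [MeasurableSpace X] {μ : Measure X} (Γ : Subgroup (mpPerm μ))

instance : MeasurableConstSMul Γ X :=
  ⟨fun c => c.1.2.1.measurable⟩

instance : SMulInvariantMeasure Γ X μ :=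
  ⟨fun c _ hs => c.1.2.1.measure_preimage hs.nullMeasurableSet⟩

theorem AutMP.range_ofAction : (AutMP.ofAction Γ μ).range = Γ.map (AutMP.mk μ) := by
  change ((AutMP.mk μ).comp Γ.subtype).range = _
  rw [MonoidHom.range_comp, Subgroup.range_subtype]

end SubgroupActions

namespace Cantor

/-- The endomorphism of the Cantor group that inserts the digit `0` in front. -/
def shift : Cantor →+ Cantor where
  toFun y n := n.casesOn 0 y
  map_zero' := funext fun n => by cases n <;> rfl
  map_add' _ _ := funext fun n => by cases n <;> simp

theorem shift_injective : Function.Injective shift :=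
  fun _ _ h => funext fun n => congrFun h (n + 1)

theorem continuous_shift : Continuous shift := by
  refine continuous_pi fun n => ?_
  cases n with
  | zero => exact continuous_const
  | succ n => exact continuous_apply n

end Cantor

section Shear

variable {J : Type*}

/-- The inverse of the shear along `q`, by recursion on the index of the digit. -/
def unshear (q : J → J) (y : J → Cantor) : J → Cantor
  | j, 0 => y j 0
  | j, n + 1 => y j (n + 1) - unshear q y (q j) n

/-- The shear of `J → Cantor` along a self-map `q` of `J`. The shift makes it invertible whatever
`q` is, and allows one to recover `q` from it. -/
def shear (q : J → J) : (J → Cantor) ≃+ (J → Cantor) where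
  toFun x j := x j + Cantor.shift (x (q j))
  invFun := unshear q
  left_inv x := by
    funext j n
    induction n generalizing j with
    | zero => simp [unshear, Cantor.shift]
    | succ n ih => exact sub_eq_iff_eq_add.2 (congrArg (x j (n + 1) + ·) (ih (q j)).symm)
  right_inv y := by
    funext j n
    cases n <;> simp [unshear, Cantor.shift]
  map_add' x y := by
    funext j
    simp only [Pi.add_apply, map_add]
    exact add_add_add_comm _ _ _ _

theorem continuous_shear (q : J → J) : Continuous (shear q) :=
  continuous_pi fun j =>
    (continuous_apply j).add (Cantor.continuous_shift.comp (continuous_apply (q j)))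

variable [Countable J]

theorem addEquiv_mem_mpPerm_cantorHaar (f : (J → Cantor) ≃+ (J → Cantor)) (hf : Continuous f) :
    f.toEquiv ∈ mpPerm (cantorHaar J) :=
  ⟨measurePreserving_cantorHaar f.toAddMonoidHom hf f.surjective,
    measurePreserving_cantorHaar f.symm.toAddMonoidHom
      (Continuous.continuous_symm_of_equiv_compact_to_t2 (f := f.toEquiv) hf) f.symm.surjective⟩

/-- The shears as measure preserving bijections. -/
noncomputable def shearMP (q : J → J) : mpPerm (cantorHaar J) :=
  ⟨(shear q).toEquiv, addEquiv_mem_mpPerm_cantorHaar _ (continuous_shear q)⟩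

theorem commute_shearMP_coordAut_iff {q : J → J} {ρ : Equiv.Perm J} :
    Commute (AutMP.mk _ (shearMP q)) (coordAut J ρ) ↔ Function.Commute ρ q := by
  have hpoint : ∀ x : J → Cantor, shear q (coordPerm J ρ x) = coordPerm J ρ (shear q x) ↔
      ∀ j, x (ρ⁻¹ (q j)) = x (q (ρ⁻¹ j)) := fun x =>
    funext_iff.trans (forall_congr' fun j => (add_right_inj (x (ρ⁻¹ j))).trans
      Cantor.shift_injective.eq_iff)
  have hinv : Commute (AutMP.mk _ (shearMP q)) (coordAut J ρ) ↔ Function.Commute ⇑ρ⁻¹ q := by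
    refine (AutMP.commute_mk_iff.trans (eventually_congr (Eventually.of_forall hpoint))).trans ?_
    exact ae_all_iff.trans (forall_congr' fun j =>
      ⟨eq_of_ae_eq_coord, fun h => Eventually.of_forall fun x => congrArg x h⟩)
  exact hinv.trans ⟨fun h => h.inverse_left ρ.right_inv ρ.left_inv,
    fun h => h.inverse_left ρ.left_inv ρ.right_inv⟩

end Shear

section UnaryAlgebra

variable {J ι : Type*}

/-- The automorphism group of the unary algebra `(J, (q i)ᵢ)`. -/
def unaryAut (q : ι → J → J) : Subgroup (Equiv.Perm J) where
  carrier := {ρ | ∀ i, Function.Commute ρ (q i)}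
  mul_mem' hρ hτ i := (hρ i).comp_left (hτ i)
  one_mem' _ := Function.Commute.id_left
  inv_mem' {ρ} hρ i := (hρ i).inverse_left ρ.left_inv ρ.right_inv

variable [Countable J]

/-- The group of measure preserving bijections of `J → Cantor` generated by the diagonal prefix
permutations and the shears along the operations `q i`. -/
noncomputable def actingGroup (q : ι → J → J) : Subgroup (mpPerm (cantorHaar J)) :=
  Subgroup.closure (Set.range (fun p : Σ N, Equiv.Perm (Fin N → ZMod 2) => diagMP J p.1 p.2) ∪
    Set.range fun i => shearMP (q i))

instance [Countable ι] (q : ι → J → J) : Countable (actingGroup q) :=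
  countable_subgroup_closure ((Set.countable_range _).union (Set.countable_range _))

theorem diagMP_mem_actingGroup (q : ι → J → J) (N : ℕ) (g : Equiv.Perm (Fin N → ZMod 2)) :
    diagMP J N g ∈ actingGroup q :=
  Subgroup.subset_closure (Or.inl ⟨⟨N, g⟩, rfl⟩)

instance (q : ι → J → J) : ErgodicSMul (actingGroup q) (J → Cantor) (cantorHaar J) where
  aeconst_of_forall_preimage_smul_ae_eq hs h :=
    eventuallyConst_of_diagPerm_preimage_ae_eq hs fun N g =>
      h ⟨diagMP J N g, diagMP_mem_actingGroup q N g⟩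

theorem centralizer_range_ofAction_actingGroup (q : ι → J → J) :
    Subgroup.centralizer
        ((AutMP.ofAction (actingGroup q) (cantorHaar J)).range : Set (AutMP (cantorHaar J))) =
      (unaryAut q).map (coordAut J) := by
  rw [AutMP.range_ofAction, actingGroup, MonoidHom.map_closure, Subgroup.centralizer_closure]
  ext c
  have hc : c ∈ Subgroup.centralizer (AutMP.mk (cantorHaar J) ''
      (Set.range (fun p : Σ N, Equiv.Perm (Fin N → ZMod 2) => diagMP J p.1 p.2) ∪
        Set.range fun i => shearMP (q i))) ↔
      c ∈ (coordAut J).range ∧ ∀ i, Commute (AutMP.mk _ (shearMP (q i))) c := by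
    simp only [Subgroup.mem_centralizer_iff, Set.forall_mem_image, Set.mem_union, or_imp,
      forall_and, Set.forall_mem_range, Sigma.forall, mem_range_coordAut_iff, commute_iff_eq]
  rw [hc, Subgroup.mem_map]
  constructor
  · rintro ⟨⟨ρ, rfl⟩, hρ⟩
    exact ⟨ρ, fun i => commute_shearMP_coordAut_iff.1 (hρ i), rfl⟩
  · rintro ⟨ρ, hρ, rfl⟩
    exact ⟨⟨ρ, rfl⟩, fun i => commute_shearMP_coordAut_iff.2 (hρ i)⟩

theorem isCentralizerGroup_of_unaryAut {J : Type} [Countable J] [TopologicalSpace J]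
    [DiscreteTopology J] [Countable ι] (q : ι → J → J) {H : Type*} [Group H] [TopologicalSpace H]
    [IsTopologicalGroup H] [PolishSpace H] (φ : H →* Equiv.Perm J)
    (hφ : IsEmbedding fun h => ⇑(φ h)) (hrange : φ.range = unaryAut q) :
    IsCentralizerGroup H := by
  refine ⟨inferInstance, inferInstance, J → Cantor, inferInstance, inferInstance, cantorHaar J,
    inferInstance, actingGroup q, inferInstance, inferInstance, inferInstance, inferInstance,
    inferInstance, ?_⟩
  refine nonempty_continuousMulEquiv_of_isEmbedding (f := (coordAut J).comp φ)
    (isEmbedding_coordAut_comp hφ) ?_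
  rw [centralizer_range_ofAction_actingGroup, MonoidHom.range_comp, hrange]

end UnaryAlgebra

namespace SInfty

theorem isEmbedding_coe : IsEmbedding fun σ : SInfty => ⇑σ :=
  ⟨⟨rfl⟩, DFunLike.coe_injective⟩

theorem continuous_apply (n : ℕ) : Continuous fun σ : SInfty => σ n :=
  continuous_pi_iff.1 isEmbedding_coe.continuous n

theorem continuous_iff {T : Type*} [TopologicalSpace T] {f : T → SInfty} :
    Continuous f ↔ ∀ n, Continuous fun t => f t n :=
  isEmbedding_coe.continuous_iff.trans continuous_pi_iff

instance : IsTopologicalGroup SInfty where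
  continuous_mul := isEmbedding_coe.continuous_iff.2 (continuous_comp_of_discrete.comp
    (isEmbedding_coe.continuous.prodMap isEmbedding_coe.continuous))
  continuous_inv := continuous_iff.2 (continuous_perm_inv_apply continuous_apply)

theorem range_coe_prod_inv :
    (Set.range fun σ : SInfty => (⇑σ, ⇑σ⁻¹)) =
      {p : (ℕ → ℕ) × (ℕ → ℕ) | p.1 ∘ p.2 = id ∧ p.2 ∘ p.1 = id} := by
  ext p
  constructor
  · rintro ⟨σ, rfl⟩
    exact ⟨σ.self_comp_symm, σ.symm_comp_self⟩
  · rintro ⟨hright, hleft⟩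
    exact ⟨⟨p.1, p.2, congrFun hleft, congrFun hright⟩, rfl⟩

-- The range of `σ ↦ σ` alone is not closed in `ℕ → ℕ`; recording `σ⁻¹` as well makes it closed.
theorem isClosedEmbedding_coe_prod_inv :
    IsClosedEmbedding fun σ : SInfty => (⇑σ, ⇑σ⁻¹) := by
  have hcont : Continuous fun σ : SInfty => (⇑σ, ⇑σ⁻¹) :=
    isEmbedding_coe.continuous.prodMk (isEmbedding_coe.continuous.comp continuous_inv)
  refine ⟨.of_comp hcont continuous_fst isEmbedding_coe, ?_⟩
  rw [range_coe_prod_inv]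
  exact (isClosed_eq continuous_comp_of_discrete continuous_const).inter
    (isClosed_eq (continuous_comp_of_discrete.comp continuous_swap) continuous_const)

instance : PolishSpace SInfty :=
  isClosedEmbedding_coe_prod_inv.polishSpace

theorem mem_of_forall_exists_eqOn {S : Set SInfty} (hS : IsClosed S) {σ : SInfty}
    (h : ∀ n, ∃ τ ∈ S, Set.EqOn τ σ (Set.Iic n)) : σ ∈ S := by
  choose τ hτS hτ using h
  refine hS.mem_of_tendsto (b := atTop) (f := τ) ?_ (Eventually.of_forall hτS)
  refine isEmbedding_coe.tendsto_nhds_iff.2 (tendsto_pi_nhds.2 fun k => ?_)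
  exact tendsto_const_nhds.congr' ((eventually_ge_atTop k).mono fun n hn => (hτ n hn).symm)

end SInfty

/-- The carrier of a unary algebra whose automorphism group is the closure of `G`: the natural
numbers, together with the `G`-orbits of all tuples `(0, …, n)`. -/
abbrev OrbitAlgebra (G : Subgroup SInfty) : Type :=
  ℕ ⊕ Σ n : ℕ, MulAction.orbit G (Fin.val : Fin (n + 1) → ℕ)

namespace OrbitAlgebra

variable {G : Subgroup SInfty}

/-- The operations of the orbit algebra: `entry l` maps a tuple to its entry of index `l`. It fixes
the natural numbers and the tuples without such an entry. -/
def entry (l : ℕ) : OrbitAlgebra G → OrbitAlgebra G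
  | .inl k => .inl k
  | .inr ⟨n, s⟩ => if h : l < n + 1 then .inl (s.1 ⟨l, h⟩) else .inr ⟨n, s⟩

theorem entry_inr_of_lt {n l : ℕ} (h : l < n + 1)
    (s : MulAction.orbit G (Fin.val : Fin (n + 1) → ℕ)) :
    entry l (.inr ⟨n, s⟩) = .inl (s.1 ⟨l, h⟩) :=
  dif_pos h

theorem entry_inr_eq_self_iff {n l : ℕ} {s : MulAction.orbit G (Fin.val : Fin (n + 1) → ℕ)} :
    entry l (.inr ⟨n, s⟩) = .inr ⟨n, s⟩ ↔ n < l := by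
  simp [entry]

theorem toPerm_mem_unaryAut_entry (g : G) :
    MulAction.toPermHom G (OrbitAlgebra G) g ∈ unaryAut entry := by
  rintro l (k | ⟨n, s⟩)
  · rfl
  · rcases Nat.lt_or_ge n l with h | h
    · exact (congrArg (g • ·) (entry_inr_eq_self_iff (s := s).2 h)).trans
        (entry_inr_eq_self_iff (s := g • s).2 h).symm
    · have hl := Nat.lt_succ_of_le h
      exact (congrArg (g • ·) (entry_inr_of_lt hl s)).trans (entry_inr_of_lt hl (g • s)).symm

section Rigidity

variable {ρ : Equiv.Perm (OrbitAlgebra G)}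

theorem entry_apply_eq_self_iff (hρ : ρ ∈ unaryAut entry) (l : ℕ) (j : OrbitAlgebra G) :
    entry l (ρ j) = ρ j ↔ entry l j = j := by
  rw [← hρ l j, ρ.injective.eq_iff]

theorem exists_apply_inl_eq (hρ : ρ ∈ unaryAut entry) (k : ℕ) :
    ∃ m, ρ (.inl k) = .inl m := by
  have hfix := (entry_apply_eq_self_iff hρ 0 (.inl k)).2 rfl
  rcases hj : ρ (.inl k) with m | ⟨n, s⟩
  · exact ⟨m, rfl⟩
  · rw [hj, entry_inr_eq_self_iff] at hfix
    exact absurd hfix n.not_lt_zero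

theorem exists_perm_apply_inl_eq (hρ : ρ ∈ unaryAut entry) :
    ∃ σ : SInfty, ∀ k, ρ (.inl k) = .inl (σ k) := by
  choose f hf using exists_apply_inl_eq hρ
  choose f' hf' using exists_apply_inl_eq (inv_mem hρ)
  refine ⟨⟨f, f', fun k => ?_, fun k => ?_⟩, hf⟩
  · exact Sum.inl.inj ((hf' (f k)).symm.trans (ρ.symm_apply_eq.2 (hf k).symm))
  · exact Sum.inl.inj ((hf (f' k)).symm.trans (ρ.symm_apply_eq.1 (hf' k)).symm)

theorem exists_apply_inr_eq (hρ : ρ ∈ unaryAut entry) {σ : SInfty}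
    (hσ : ∀ k, ρ (.inl k) = .inl (σ k)) {n : ℕ}
    (s : MulAction.orbit G (Fin.val : Fin (n + 1) → ℕ)) :
    ∃ t : MulAction.orbit G (Fin.val : Fin (n + 1) → ℕ),
      ρ (.inr ⟨n, s⟩) = .inr ⟨n, t⟩ ∧ t.1 = σ ∘ s.1 := by
  have hfix l := (entry_apply_eq_self_iff hρ l (.inr ⟨n, s⟩)).trans entry_inr_eq_self_iff
  rcases hj : ρ (.inr ⟨n, s⟩) with m | ⟨m, t⟩
  · rw [hj] at hfix
    exact absurd ((hfix 0).1 rfl) n.not_lt_zero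
  · simp only [hj, entry_inr_eq_self_iff] at hfix
    obtain rfl : m = n := eq_of_forall_gt_iff hfix
    refine ⟨t, rfl, funext fun i => ?_⟩
    have hi : (.inl (t.1 i) : OrbitAlgebra G) = .inl (σ (s.1 i)) :=
      calc Sum.inl (t.1 i) = entry i (ρ (.inr ⟨m, s⟩)) := by rw [hj, entry_inr_of_lt i.2]
        _ = ρ (entry i (.inr ⟨m, s⟩)) := (hρ i _).symm
        _ = .inl (σ (s.1 i)) := by rw [entry_inr_of_lt i.2, hσ]
    exact Sum.inl.inj hi

theorem mem_of_apply_inl_eq (hG : IsClosed (G : Set SInfty)) (hρ : ρ ∈ unaryAut entry)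
    {σ : SInfty} (hσ : ∀ k, ρ (.inl k) = .inl (σ k)) : σ ∈ G := by
  refine SInfty.mem_of_forall_exists_eqOn hG fun n => ?_
  obtain ⟨⟨t, g, hg⟩, -, ht⟩ := exists_apply_inr_eq hρ hσ (n := n) ⟨_, MulAction.mem_orbit_self _⟩
  exact ⟨g, g.2, fun k hk => congrFun (hg.trans ht) ⟨k, Nat.lt_succ_of_le hk⟩⟩

theorem range_toPermHom_eq_unaryAut (hG : IsClosed (G : Set SInfty)) :
    (MulAction.toPermHom G (OrbitAlgebra G)).range = unaryAut entry := by
  refine le_antisymm (fun _ ⟨g, hg⟩ => hg ▸ toPerm_mem_unaryAut_entry g) fun ρ hρ => ?_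
  obtain ⟨σ, hσ⟩ := exists_perm_apply_inl_eq hρ
  refine ⟨⟨σ, mem_of_apply_inl_eq hG hρ hσ⟩, Equiv.ext ?_⟩
  rintro (k | ⟨n, s⟩)
  · exact (hσ k).symm
  · obtain ⟨t, hρt, ht⟩ := exists_apply_inr_eq hρ hσ s
    obtain rfl : (⟨σ, mem_of_apply_inl_eq hG hρ hσ⟩ : G) • s = t := Subtype.ext ht.symm
    exact hρt.symm

end Rigidity

theorem isEmbedding_toPermHom :
    IsEmbedding fun g : G => ⇑(MulAction.toPermHom G (OrbitAlgebra G) g) := by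
  have happly (k : ℕ) : Continuous fun g : G => (g : SInfty) k :=
    (SInfty.continuous_apply k).comp continuous_subtype_val
  have hcont : Continuous fun g : G => ⇑(MulAction.toPermHom G (OrbitAlgebra G) g) := by
    refine continuous_pi ?_
    rintro (k | ⟨n, s⟩)
    · exact continuous_inl.comp (happly k)
    · exact continuous_inr.comp (continuous_sigmaMk.comp
        ((continuous_pi fun i => happly (s.1 i)).subtype_mk fun g => (g • s).2))
  have hrestrict : Continuous fun (f : OrbitAlgebra G → OrbitAlgebra G) (k : ℕ) => f (.inl k) :=
    continuous_pi fun k => continuous_apply _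
  refine .of_comp hcont hrestrict ?_
  exact (IsEmbedding.piMap fun _ : ℕ => IsEmbedding.inl).comp
    (SInfty.isEmbedding_coe.comp IsEmbedding.subtypeVal)

end OrbitAlgebra

theorem mainTheorem3 (G : Subgroup SInfty) (hG : IsClosed (G : Set SInfty)) :
    IsCentralizerGroup G := by
  have : PolishSpace G := hG.polishSpace
  exact isCentralizerGroup_of_unaryAut OrbitAlgebra.entry _ OrbitAlgebra.isEmbedding_toPermHom
    (OrbitAlgebra.range_toPermHom_eq_unaryAut hG)
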